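/- Let ${\bf E}^2$ be the Cayley graph of ${\bf Z}^2$ with respect to the generators $e_1=(1,0)$, $e_2=(0,1)$ (the unit square lattice), and let $H_1({\bf E}^2)$ be its first integral homology group, i.e. the group of integral 1-cycles, on which ${\bf Z}^2$ acts by shifts; write $\gamma^{v}$ for the cycle $\gamma$ shifted by $v$. The boundaries $p(m,n)$ of the unit squares with lower left corner $(m,n)$, oriented counterclockwise (plaquettes), are free generators of $H_1({\bf E}^2)$; for $\gamma=\sum k_{(m,n)}\,p(m,n)$ let $S(\gamma)=\sum k_{(m,n)}$ be its algebraic area. A 2-cocycle $y:{\bf Z}^2\times{\bf Z}^2\to H_1({\bf E}^2)$, $y(g,h)+y(g+h,j)=y(h,j)^{g}+y(g,h+j)$, is normalized if $y(0,g)=y(g,0)=0$ for all $g$. Such a $y$ determines the extension $G_y=H_1({\bf E}^2)\times{\bf Z}^2$ of ${\bf Z}^2$ by $H_1({\bf E}^2)$ with the law $(\gamma_1,g)(\gamma_2,h)=(\gamma_1+\gamma_2^{\,g}+y(g,h),\,g+h)$. Put $$\gamma_y=y(e_1,e_2)-y(e_1,-e_1)^{e_2}+y(e_1+e_2,-e_1).$$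 For each $g\in{\bf Z}^2$ choose a lattice path $\omega_g$ from $0$ to $g$, and let $c(g,h)\in H_1({\bf E}^2)$ be the class of the loop that runs along $\omega_g$, then along $\omega_h$ shifted by $g$, and then back along $\omega_{g+h}$. This is a 2-cocycle. Let $\tilde c$ be the class of the cocycle $c$ obtained when $\omega_{(m,n)}$ goes first along the first axis and then vertically. Theorem. (1) Every class in $H^2({\bf Z}^2,H_1({\bf E}^2))$ contains a normalized cocycle, and for every normalized cocycle $y$ the commutator $[a,b]=aba^{-1}b^{-1}$ of the lifts $a=(0,e_1)$ and $b=(0,e_2)$ in $G_y$ is $(\gamma_y,0)$. (2) If normalized cocycles $y,y'$ are cohomologous, then $S(\gamma_y)=S(\gamma_{y'})$. (3) There is a group isomorphism $\beta:H^2({\bf Z}^2,H_1({\bf E}^2))\to{\bf Z}$ with $\beta([y])=S(\gamma_y)$ for every normalized cocycle $y$; also $\beta([y])=S\bigl(y(e_1,e_2)^{-e_1-e_2}-y(e_1,-e_1)^{-e_2}+y(e_1+e_2,-e_1)^{-e_2}\bigr)$. Moreover $\beta(\tilde c)=1$. (4) Every choice of paths $(\omega_g)$ gives a cocycle in the class $\tilde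 c$. The class $\tilde c$ determines the free metabelian group ${\rm Met}(2)=F_2/F_2''$: for every normalized cocycle $y\in\tilde c$ there is an isomorphism ${\rm Met}(2)\to G_y$ under which the element represented by a word $w$ in $x_1^{\pm1},x_2^{\pm1}$ has as its ${\bf Z}^2$-component the end point of the lattice path that starts at $0$ and spells $w$, and which sends that element to $(\gamma,0)$ with $\gamma$ the cycle of this path if the path is closed. -/

import Mathlib

/-!
The square lattice as a graph, its first homology, the second cohomology of `ℤ²` with values
in it, group extensions given by 2-cocycles, and the free metabelian group of rank two.
-/

noncomputable section

namespace SquareLattice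

/-! ### The lattice graph and its first homology -/

/-- The lattice `ℤ²`: the vertices of the Cayley graph `E²`. -/
abbrev Z2 : Type := ℤ × ℤ

/-- The two standard generators of `ℤ²`; `e 0 = (1, 0)` and `e 1 = (0, 1)`. -/
def e : Fin 2 → Z2 := ![(1, 0), (0, 1)]

/-- An oriented edge of the Cayley graph of `ℤ²`: the pair `(v, i)` is the unit edge
from `v` to `v + e i`. -/
abbrev Edge : Type := Z2 × Fin 2

/-- Integral cellular 1-chains of the graph. -/
abbrev Chain1 : Type := Edge →₀ ℤ

/-- Integral 0-chains of the graph. -/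
abbrev Chain0 : Type := Z2 →₀ ℤ

/-- The edge from `v` to `v + e i`, as a 1-chain. -/
def edge (v : Z2) (i : Fin 2) : Chain1 := Finsupp.single (v, i) 1

/-- The cellular boundary map: an edge goes to its end point minus its starting point. -/
def boundary : Chain1 →ₗ[ℤ] Chain0 :=
  Finsupp.linearCombination ℤ fun a : Edge =>
    Finsupp.single (a.1 + e a.2) (1 : ℤ) - Finsupp.single a.1 1

@[simp] lemma boundary_edge (v : Z2) (i : Fin 2) :
    boundary (edge v i) = Finsupp.single (v + e i) (1 : ℤ) - Finsupp.single v 1 := by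
  simp [boundary, edge]

/-- `H₁(E²; ℤ)`: since `E²` is one-dimensional this is the group of integral 1-cycles. -/
abbrev H1 : Type := LinearMap.ker boundary

/-! ### The action of `ℤ²` by shifts -/

/-- The shift of 1-chains by the vector `v`. -/
def shiftChain (v : Z2) : Chain1 →ₗ[ℤ] Chain1 :=
  Finsupp.lmapDomain ℤ ℤ fun a : Edge => (v + a.1, a.2)

/-- The shift of 0-chains by the vector `v`. -/
def shiftChain0 (v : Z2) : Chain0 →ₗ[ℤ] Chain0 :=
  Finsupp.lmapDomain ℤ ℤ fun w : Z2 => v + w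

@[simp] lemma shiftChain_edge (v w : Z2) (i : Fin 2) :
    shiftChain v (edge w i) = edge (v + w) i := by
  simp [shiftChain, edge, Finsupp.mapDomain_single]

lemma chain1_hom_ext {M : Type*} [AddCommGroup M] {f g : Chain1 →ₗ[ℤ] M}
    (h : ∀ v i, f (edge v i) = g (edge v i)) : f = g := by
  refine Finsupp.lhom_ext' fun a => LinearMap.ext_ring ?_
  exact h a.1 a.2

lemma boundary_shiftChain (v : Z2) (γ : Chain1) :
    boundary (shiftChain v γ) = shiftChain0 v (boundary γ) := by
  have : boundary ∘ₗ shiftChain v = shiftChain0 v ∘ₗ boundary := by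
    refine chain1_hom_ext fun w i => ?_
    simp only [LinearMap.comp_apply, shiftChain_edge, boundary_edge, map_sub]
    simp [shiftChain0, Finsupp.mapDomain_single, add_assoc]
  exact LinearMap.congr_fun this γ

lemma shiftChain_mem (v : Z2) (γ : H1) : shiftChain v (γ : Chain1) ∈ LinearMap.ker boundary := by
  have h : boundary (γ : Chain1) = 0 := γ.2
  rw [LinearMap.mem_ker, boundary_shiftChain, h, map_zero]

lemma shiftChain_zero : shiftChain 0 = LinearMap.id :=
  chain1_hom_ext fun w i => by simp

lemma shiftChain_add (v w : Z2) : shiftChain (v + w) = shiftChain v ∘ₗ shiftChain w :=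
  chain1_hom_ext fun u i => by simp [add_assoc]

/-- The shift of cycles by the vector `v`. -/
def shift (v : Z2) : H1 →ₗ[ℤ] H1 :=
  (shiftChain v ∘ₗ (LinearMap.ker boundary).subtype).codRestrict _ (shiftChain_mem v)

@[simp] lemma coe_shift (v : Z2) (γ : H1) : ((shift v γ : H1) : Chain1) = shiftChain v γ := rfl

lemma shift_zero_apply (γ : H1) : shift 0 γ = γ :=
  Subtype.ext (by simp [shiftChain_zero])

lemma shift_add_apply (v w : Z2) (γ : H1) : shift (v + w) γ = shift v (shift w γ) :=
  Subtype.ext (by simp [shiftChain_add])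

/-- The representation of `ℤ²` on `H₁(E²)` by shifts. -/
def shiftRep : Representation ℤ (Multiplicative Z2) H1 where
  toFun g := shift g.toAdd
  map_one' := LinearMap.ext shift_zero_apply
  map_mul' g h := LinearMap.ext (shift_add_apply g.toAdd h.toAdd)

/-- `H₁(E²)` as a `ℤ²`-module. -/
abbrev homologyRep : Rep ℤ (Multiplicative Z2) := Rep.of shiftRep

/-- The cohomology group `H²(ℤ², H₁(E²))`. -/
abbrev Cohomology2 : Type := groupCohomology.H2 homologyRep

/-- The group of 2-cocycles of `ℤ²` with values in `H₁(E²)`. -/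
abbrev Cocycle2 : Type := groupCohomology.cocycles₂ homologyRep

/-- The cohomology class of a 2-cocycle. -/
def cohomologyClass (y : Cocycle2) : Cohomology2 := groupCohomology.H2π homologyRep y

/-- The value of a 2-cocycle, with the group `ℤ²` written additively. -/
def Cocycle2.val (y : Cocycle2) (g h : Z2) : H1 :=
  (y : Multiplicative Z2 × Multiplicative Z2 → H1)
    (Multiplicative.ofAdd g, Multiplicative.ofAdd h)

lemma Cocycle2.val_add (y : Cocycle2) (g h j : Z2) :
    y.val (g + h) j + y.val g h = shift g (y.val h j) + y.val g (h + j) :=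
  (groupCohomology.mem_cocycles₂_iff (A := homologyRep) _).1 y.2
    (Multiplicative.ofAdd g) (Multiplicative.ofAdd h) (Multiplicative.ofAdd j)

/-- A 2-cocycle is normalized if it vanishes as soon as one of its arguments is zero. -/
def IsNormalized (y : Cocycle2) : Prop :=
  ∀ g : Z2, y.val 0 g = 0 ∧ y.val g 0 = 0

/-! ### Plaquettes and the algebraic area -/

/-- The boundary, as a 1-chain, of the unit square whose lower left corner is `v`, oriented
counterclockwise: `v → v + e₁ → v + e₁ + e₂ → v + e₂ → v`. -/
def plaquetteChain (v : Z2) : Chain1 :=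
  edge v 0 + edge (v + e 0) 1 - edge (v + e 1) 0 - edge v 1

lemma plaquetteChain_mem (v : Z2) : plaquetteChain v ∈ LinearMap.ker boundary := by
  rw [LinearMap.mem_ker]
  simp only [plaquetteChain, map_sub, map_add, boundary_edge, add_right_comm v (e 1) (e 0)]
  abel

/-- The plaquette `p(v)`. -/
def plaquette (v : Z2) : H1 := ⟨plaquetteChain v, plaquetteChain_mem v⟩

/-- The sum `∑ k(v) p(v)` of plaquettes. -/
def plaquetteSum : (Z2 →₀ ℤ) →ₗ[ℤ] H1 := Finsupp.linearCombination ℤ plaquette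

/-- The signed sum of `f` over the integers from `0` to `n`, i.e. `∑_{0 ≤ j < n} f j`
if `n ≥ 0` and `-∑_{n ≤ j < 0} f j` otherwise. -/
def signedSum {M : Type*} [AddCommGroup M] (f : ℤ → M) (n : ℤ) : M :=
  ∑ j ∈ Finset.Ico 0 n, f j - ∑ j ∈ Finset.Ico n 0, f j

@[simp] lemma signedSum_zero {M : Type*} [AddCommGroup M] (f : ℤ → M) : signedSum f 0 = 0 := by
  simp [signedSum]

lemma signedSum_succ {M : Type*} [AddCommGroup M] (f : ℤ → M) (n : ℤ) :
    signedSum f (n + 1) = signedSum f n + f n := by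
  unfold signedSum
  rcases le_or_gt 0 n with hn | hn
  · rw [Finset.Ico_eq_empty_of_le hn, Finset.Ico_eq_empty_of_le (by omega : (0 : ℤ) ≤ n + 1),
      ← Finset.insert_Ico_right_eq_Ico_add_one hn, Finset.sum_insert (by simp)]
    simp [add_comm]
  · rw [Finset.Ico_eq_empty_of_le hn.le, Finset.Ico_eq_empty_of_le (by omega : n + 1 ≤ (0 : ℤ)),
      ← Finset.insert_Ico_add_one_left_eq_Ico hn, Finset.sum_insert (by simp)]
    simp

lemma signedSum_map {M N : Type*} [AddCommGroup M] [AddCommGroup N] [Module ℤ M] [Module ℤ N]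
    (L : M →ₗ[ℤ] N) (f : ℤ → M) (n : ℤ) :
    L (signedSum f n) = signedSum (fun j => L (f j)) n := by
  simp [signedSum, map_sub, map_sum]

/-- An additive function of `n` is determined by its increments. -/
lemma eq_of_increments {M : Type*} [AddCommGroup M] {f g : ℤ → M} (h0 : f 0 = g 0)
    (h : ∀ n, f (n + 1) - f n = g (n + 1) - g n) (n : ℤ) : f n = g n := by
  induction n using Int.induction_on with
  | zero => exact h0
  | succ k ih => simpa [ih] using h k
  | pred k ih =>
    have := h (-(k : ℤ) - 1)
    rw [sub_add_cancel, ih] at this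
    exact sub_right_injective this

/-- A chain from the origin to `v`: first along the first axis, then vertically. -/
def comb (v : Z2) : Chain1 :=
  signedSum (fun j => edge (j, 0) 0) v.1 + signedSum (fun j => edge (v.1, j) 1) v.2

/-- A 2-chain filling the cycle made of an edge and of the chains `comb` to its end points. -/
def fillEdge (a : Edge) : Z2 →₀ ℤ :=
  if a.2 = 0 then -signedSum (fun j => Finsupp.single (a.1.1, j) (1 : ℤ)) a.1.2 else 0

/-- The linear extension of `fillEdge`. -/
def fill : Chain1 →ₗ[ℤ] (Z2 →₀ ℤ) := Finsupp.linearCombination ℤ fillEdge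

lemma coe_plaquetteSum_single (v : Z2) :
    ((plaquetteSum (Finsupp.single v 1) : H1) : Chain1) = plaquetteChain v := by
  simp [plaquetteSum, plaquette]

lemma fill_edge (v : Z2) (i : Fin 2) : fill (edge v i) = fillEdge (v, i) := by
  simp [fill, edge]

lemma fill_plaquetteChain (v : Z2) : fill (plaquetteChain v) = Finsupp.single v 1 := by
  obtain ⟨m, n⟩ := v
  simp [plaquetteChain, fill_edge, fillEdge, e, signedSum_succ]

lemma sum_plaquetteChain (m n : ℤ) :
    signedSum (fun j => plaquetteChain (m, j)) n =
      edge (m, 0) 0 - edge (m, n) 0 + signedSum (fun j => edge (m + 1, j) 1) n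
        - signedSum (fun j => edge (m, j) 1) n := by
  refine eq_of_increments
    (f := fun n => signedSum (fun j => plaquetteChain (m, j)) n)
    (g := fun n => edge (m, 0) 0 - edge (m, n) 0 + signedSum (fun j => edge (m + 1, j) 1) n
        - signedSum (fun j => edge (m, j) 1) n) (by simp) (fun n => ?_) n
  simp only [signedSum_succ, plaquetteChain, e]
  simp
  abel

lemma fill_homotopy (γ : Chain1) :
    ((plaquetteSum (fill γ) : H1) : Chain1)
      + Finsupp.linearCombination ℤ comb (boundary γ) = γ := by
  have : (LinearMap.ker boundary).subtype ∘ₗ plaquetteSum ∘ₗ fill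
      + Finsupp.linearCombination ℤ comb ∘ₗ boundary = LinearMap.id := by
    refine chain1_hom_ext fun v i => ?_
    obtain ⟨m, n⟩ := v
    have key : ((plaquetteSum (signedSum (fun j => Finsupp.single (m, j) (1 : ℤ)) n) : H1) : Chain1)
        = signedSum (fun j => plaquetteChain (m, j)) n := by
      have := signedSum_map ((LinearMap.ker boundary).subtype ∘ₗ plaquetteSum)
        (fun j => Finsupp.single (m, j) (1 : ℤ)) n
      simpa [coe_plaquetteSum_single] using this
    fin_cases i
    · simp [fill_edge, fillEdge, e, comb, key, sum_plaquetteChain, signedSum_succ]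
      abel
    · simp [fill_edge, fillEdge, e, comb, signedSum_succ]
  exact LinearMap.congr_fun this γ

/-- Plaquettes are free generators of `H₁(E²)`. -/
def plaquetteEquiv : (Z2 →₀ ℤ) ≃ₗ[ℤ] H1 :=
  LinearEquiv.ofLinearMap plaquetteSum (fill ∘ₗ (LinearMap.ker boundary).subtype)
    (LinearMap.ext fun γ => Subtype.ext <| by
      have h : boundary (γ : Chain1) = 0 := γ.2
      have := fill_homotopy (γ : Chain1)
      rw [h, map_zero, add_zero] at this
      exact this)
    (Finsupp.lhom_ext' fun v => LinearMap.ext_ring <| by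
      simp only [LinearMap.comp_apply, Submodule.subtype_apply, Finsupp.lsingle_apply,
        coe_plaquetteSum_single, fill_plaquetteChain, LinearMap.id_apply])

/-- The algebraic area of a cycle: the sum of the coefficients of its unique representation
as an integral combination of plaquettes. -/
def area (γ : H1) : ℤ := (plaquetteEquiv.symm γ).sum fun _ k => k

/-! ### The extension of `ℤ²` by `H₁(E²)` given by a normalized cocycle -/

/-- The underlying set `H₁(E²) × ℤ²` of the extension determined by a normalized cocycle. -/
@[ext] structure Extension (y : Cocycle2) (hy : IsNormalized y) : Type where
  /-- The component in `H₁(E²)`. -/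
  cycle : H1
  /-- The component in `ℤ²`. -/
  base : Z2

namespace Extension

variable {y : Cocycle2} {hy : IsNormalized y}

/-- The group law
`(γ₁, g) (γ₂, h) = (γ₁ + g γ₂ + y(g, h), g + h)`. -/
instance : Mul (Extension y hy) :=
  ⟨fun a b => ⟨a.cycle + shift a.base b.cycle + y.val a.base b.base, a.base + b.base⟩⟩

instance : One (Extension y hy) := ⟨⟨0, 0⟩⟩

instance : Inv (Extension y hy) :=
  ⟨fun a => ⟨-shift (-a.base) a.cycle - y.val (-a.base) a.base, -a.base⟩⟩

@[simp] lemma mul_cycle (a b : Extension y hy) :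
    (a * b).cycle = a.cycle + shift a.base b.cycle + y.val a.base b.base := rfl
@[simp] lemma mul_base (a b : Extension y hy) : (a * b).base = a.base + b.base := rfl
@[simp] lemma one_cycle : (1 : Extension y hy).cycle = 0 := rfl
@[simp] lemma one_base : (1 : Extension y hy).base = 0 := rfl
@[simp] lemma inv_cycle (a : Extension y hy) :
    a⁻¹.cycle = -shift (-a.base) a.cycle - y.val (-a.base) a.base := rfl
@[simp] lemma inv_base (a : Extension y hy) : a⁻¹.base = -a.base := rfl

instance : Group (Extension y hy) :=
  Group.ofLeftAxioms
    (fun a b c => by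
      refine Extension.ext ?_ (add_assoc _ _ _)
      have h := y.val_add a.base b.base c.base
      simp only [mul_cycle, mul_base, map_add, shift_add_apply]
      rw [← sub_eq_zero] at h ⊢
      rw [← h]
      abel)
    (fun a => by
      refine Extension.ext ?_ (zero_add _)
      simp [shift_zero_apply, (hy a.base).1])
    (fun a => by
      refine Extension.ext ?_ (neg_add_cancel _)
      simp only [mul_cycle, inv_cycle, inv_base, one_cycle]
      abel)

/-- The lift `(0, g)` of an element `g` of `ℤ²` to the extension. -/
def lift (hy : IsNormalized y) (g : Z2) : Extension y hy := ⟨0, g⟩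

end Extension

/-- The cycle
`y(e₁, e₂) - y(e₁, -e₁)^(e₂) + y(e₁ + e₂, -e₁)`, where `γ^v` is `γ` shifted by `v`. -/
def commutatorCycle (y : Cocycle2) : H1 :=
  y.val (e 0) (e 1) - shift (e 1) (y.val (e 0) (-e 0)) + y.val (e 0 + e 1) (-e 0)

/-- The cycle
`y(e₁, e₂)^(-e₁-e₂) - y(e₁, -e₁)^(-e₂) + y(e₁ + e₂, -e₁)^(-e₂)`. -/
def shiftedCommutatorCycle (y : Cocycle2) : H1 :=
  shift (-e 0 - e 1) (y.val (e 0) (e 1)) - shift (-e 1) (y.val (e 0) (-e 0))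
    + shift (-e 1) (y.val (e 0 + e 1) (-e 0))

/-! ### Paths in the lattice and the class defined by them -/

/-- A word in the letters `X₁, X₂` and their inverses: `(i, true)` is the letter with number `i`,
and `(i, false)` is its inverse. -/
abbrev Word : Type := List (Fin 2 × Bool)

/-- The displacement along one letter. -/
def letterStep (a : Fin 2 × Bool) : Z2 := if a.2 then e a.1 else -e a.1

/-- The oriented edge, as a 1-chain, that is run through by a letter read at the vertex `v`. -/
def letterChain (v : Z2) (a : Fin 2 × Bool) : Chain1 :=
  if a.2 then edge v a.1 else -edge (v - e a.1) a.1

/-- The end point of the path that starts at the origin and spells the given word; it is also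
the image of the word in `ℤ²`. -/
def endpoint (w : Word) : Z2 := (w.map letterStep).sum

/-- The 1-chain of the path that starts at `v` and spells the given word. -/
def pathChainFrom : Z2 → Word → Chain1
  | _, [] => 0
  | v, a :: w => letterChain v a + pathChainFrom (v + letterStep a) w

/-- The 1-chain of the path that starts at the origin and spells the given word. -/
def pathChain (w : Word) : Chain1 := pathChainFrom 0 w

lemma boundary_letterChain (v : Z2) (a : Fin 2 × Bool) :
    boundary (letterChain v a)
      = Finsupp.single (v + letterStep a) (1 : ℤ) - Finsupp.single v 1 := by
  rcases a with ⟨i, _ | _⟩ <;> simp [letterChain, letterStep, sub_eq_add_neg]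

lemma boundary_pathChainFrom (v : Z2) (w : Word) :
    boundary (pathChainFrom v w)
      = Finsupp.single (v + endpoint w) (1 : ℤ) - Finsupp.single v 1 := by
  induction w generalizing v with
  | nil => simp [pathChainFrom, endpoint]
  | cons a w ih =>
    rw [pathChainFrom, map_add, ih, boundary_letterChain]
    simp [endpoint, add_assoc]

/-- A choice, for every `g` in `ℤ²`, of a path from the origin to `g`, or equivalently of a
word that represents `g`. -/
structure PathSystem : Type where
  /-- The chosen words. -/
  word : Z2 → Word
  /-- The word chosen for `g` represents `g`. -/
  endpoint_word : ∀ g, endpoint (word g) = g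

namespace PathSystem

variable (ω : PathSystem)

/-- The 1-chain of the loop that goes to `g` along the path of `g`, then to `g + h` along the
path of `h` shifted by `g`, and then back along the path of `g + h`. -/
def loopChain (g h : Z2) : Chain1 :=
  pathChain (ω.word g) + shiftChain g (pathChain (ω.word h)) - pathChain (ω.word (g + h))

lemma boundary_path (g : Z2) :
    boundary (pathChain (ω.word g)) = Finsupp.single g (1 : ℤ) - Finsupp.single 0 1 := by
  rw [pathChain, boundary_pathChainFrom, ω.endpoint_word, zero_add]

lemma loopChain_mem (g h : Z2) : ω.loopChain g h ∈ LinearMap.ker boundary := by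
  rw [LinearMap.mem_ker]
  simp only [loopChain, map_sub, map_add, boundary_shiftChain, boundary_path]
  simp [shiftChain0, Finsupp.mapDomain_single]

/-- The homology class of the loop. -/
def loop (g h : Z2) : H1 := ⟨ω.loopChain g h, ω.loopChain_mem g h⟩

/-- The 2-cocycle `c(g, h)` defined by a system of paths. -/
def cocycle : Cocycle2 :=
  ⟨fun p => ω.loop p.1.toAdd p.2.toAdd, by
    refine (groupCohomology.mem_cocycles₂_iff (A := homologyRep) _).2 fun g h j => ?_
    refine Subtype.ext ?_
    change ω.loopChain (g.toAdd + h.toAdd) j.toAdd + ω.loopChain g.toAdd h.toAdd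
      = shiftChain g.toAdd (ω.loopChain h.toAdd j.toAdd)
        + ω.loopChain g.toAdd (h.toAdd + j.toAdd)
    simp only [loopChain, map_sub, map_add, shiftChain_add, LinearMap.comp_apply, add_assoc]
    abel⟩

end PathSystem

/-- The word `Xᵢⁿ`. -/
def powerWord (i : Fin 2) (n : ℤ) : Word := List.replicate n.natAbs (i, decide (0 ≤ n))

lemma endpoint_powerWord (i : Fin 2) (n : ℤ) : endpoint (powerWord i n) = n • e i := by
  rcases le_or_gt 0 n with h | h
  · simp only [endpoint, powerWord, letterStep, List.map_replicate, List.sum_replicate, h,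
      decide_true, if_true]
    rw [← natCast_zsmul, Int.natAbs_of_nonneg h]
  · simp only [endpoint, powerWord, letterStep, List.map_replicate, List.sum_replicate,
      not_le.2 h, decide_false, Bool.false_eq_true, if_false]
    rw [← natCast_zsmul, Int.ofNat_natAbs_of_nonpos h.le, smul_neg, neg_smul, neg_neg]

/-- The system of paths in which `(m, n)` is represented by the word `X₁ᵐ X₂ⁿ`. -/
def standardPaths : PathSystem where
  word g := powerWord 0 g.1 ++ powerWord 1 g.2
  endpoint_word g := by
    have h := congrArg₂ (· + ·) (endpoint_powerWord 0 g.1) (endpoint_powerWord 1 g.2)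
    simp only [endpoint, List.map_append, List.sum_append] at h ⊢
    rw [h]
    simp [e]

/-- The class `c̃`. -/
def metabelianClass : Cohomology2 := cohomologyClass standardPaths.cocycle

/-! ### The free metabelian group -/

/-- The free metabelian group of rank two: the quotient of the free group on two generators
by its second derived subgroup. -/
abbrev Met2 : Type := FreeGroup (Fin 2) ⧸ derivedSeries (FreeGroup (Fin 2)) 2

/-- The element of the free metabelian group represented by a word. -/
def Met2.ofWord (w : Word) : Met2 := QuotientGroup.mk (FreeGroup.mk w)

end SquareLattice

end

open SquareLattice

/-!
Everything rests on the cycle `y(e₁, e₂) - y(e₂, e₁)` (`asymmetry`) and on the freeness of the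
plaquettes.

For a normalized cocycle `asymmetry y` is the commutator cycle of the two lifts. Its area is
unchanged by adding a coboundary to `y`, because the area is additive and invariant under shifts;
hence it is a homomorphism `H² → ℤ`. It is onto since the cocycle of the standard paths gives one
plaquette. It is injective: all plaquettes agree modulo `(e₁ - 1) H₁ + (e₂ - 1) H₁`, so a
cycle of area zero lies in this submodule (`mem_augmentation_of_area`), and it can then be absorbed
by changing the two lifts until they commute. Commuting lifts split the extension
(`Extension.class_eq_zero_of_commute`).

A cocycle in the class of the path cocycles is the coboundary of a function `u` with values in
the 1-chains, `u g` leading from the origin to `g`. Adding `u` embeds the extension into the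
semidirect product of the 1-chains with `ℤ²`, and the homomorphism from the free group which
assigns the edges at the origin to the generators sends a word to the chain and the end point of its
path. The extension is metabelian, so this factors through the free metabelian group. There the
words that end at the origin are products of conjugates of the commutator of the generators;
such a conjugate depends only on a vertex `v` of the lattice, and its image is the plaquette `p(v)`.
Since the conjugates commute and the plaquettes are free generators of `H₁(E²)`, the
homomorphism from the free metabelian group is bijective (`Trivialization.bijective`).
-/

namespace SquareLattice

open scoped commutatorElement

/-! ### Cocycles and coboundaries -/

/-- Two cocycles are cohomologous if and only if they differ by the coboundary of a
function `x : ℤ² → H₁(E²)`. -/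
lemma cohomologyClass_eq_iff {y y' : Cocycle2} :
    cohomologyClass y = cohomologyClass y' ↔
      ∃ x : Z2 → H1, ∀ g h, y.val g h = y'.val g h + (shift g (x h) - x (g + h) + x g) := by
  unfold cohomologyClass
  rw [groupCohomology.H2π_eq_iff]
  constructor
  · rintro ⟨x, hx⟩
    refine ⟨fun g => x (Multiplicative.ofAdd g), fun g h => ?_⟩
    have := congrFun hx (Multiplicative.ofAdd g, Multiplicative.ofAdd h)
    exact (add_eq_of_eq_sub' this).symm
  · rintro ⟨x, hx⟩
    refine ⟨fun g => x g.toAdd, funext fun p => ?_⟩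
    exact eq_sub_of_add_eq' (hx p.1.toAdd p.2.toAdd).symm

lemma Cocycle2.val_zero_left (y : Cocycle2) (g : Z2) : y.val 0 g = y.val 0 0 := by
  have h := y.val_add 0 0 g
  rw [shift_zero_apply, zero_add, zero_add] at h
  exact (add_left_cancel h).symm

lemma Cocycle2.val_zero_right (y : Cocycle2) (g : Z2) : y.val g 0 = shift g (y.val 0 0) := by
  have h := y.val_add g 0 0
  rw [add_zero, add_zero] at h
  exact add_right_cancel h

/-- Subtracting the coboundary of the constant function with value `y(0, 0)` makes a cocycle
normalized. -/
lemma exists_isNormalized (x : Cohomology2) :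
    ∃ y : Cocycle2, IsNormalized y ∧ cohomologyClass y = x := by
  refine groupCohomology.H2_induction_on (A := homologyRep) x fun (y : Cocycle2) => ?_
  let d : Cocycle2 :=
    ⟨groupCohomology.d₁₂ homologyRep fun _ => -y.val 0 0,
      groupCohomology.d₁₂_apply_mem_cocycles₂ _⟩
  have key : ∀ g h, Cocycle2.val (y + d) g h = y.val g h +
      (shift g (-y.val 0 0) - -y.val 0 0 + -y.val 0 0) := fun g h => rfl
  refine ⟨y + d, fun g => ⟨?_, ?_⟩, cohomologyClass_eq_iff.2 ⟨fun _ => -y.val 0 0, key⟩⟩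
  · rw [key, y.val_zero_left, map_neg, shift_zero_apply]
    abel
  · rw [key, y.val_zero_right, map_neg]
    abel

/-! ### The commutator cycle -/

/-- The failure of symmetry at `(e₁, e₂)`. Unlike `commutatorCycle`, it has an area that is
invariant under adding a coboundary to an arbitrary, not necessarily normalized, cocycle. -/
noncomputable def asymmetry : Cocycle2 →ₗ[ℤ] H1 where
  toFun y := y.val (e 0) (e 1) - y.val (e 1) (e 0)
  map_add' y z := by
    change y.val _ _ + z.val _ _ - (y.val _ _ + z.val _ _) = _
    abel
  map_smul' k y := by
    change k • y.val _ _ - k • y.val _ _ = _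
    rw [← smul_sub]; rfl

lemma asymmetry_apply (y : Cocycle2) :
    asymmetry y = y.val (e 0) (e 1) - y.val (e 1) (e 0) := rfl

lemma commutatorCycle_eq {y : Cocycle2} (hy : IsNormalized y) :
    commutatorCycle y = asymmetry y := by
  have h := y.val_add (e 1) (e 0) (-e 0)
  rw [add_neg_cancel, (hy _).2, add_zero, add_comm (e 1)] at h
  rw [commutatorCycle, ← h, asymmetry_apply]
  abel

lemma lift_commutator {y : Cocycle2} (hy : IsNormalized y) :
    Extension.lift hy (e 0) * Extension.lift hy (e 1)
        * (Extension.lift hy (e 0))⁻¹ * (Extension.lift hy (e 1))⁻¹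
      = (⟨commutatorCycle y, 0⟩ : Extension y hy) := by
  rw [mul_inv_eq_iff_eq_mul, mul_inv_eq_iff_eq_mul, commutatorCycle_eq hy, asymmetry_apply]
  refine Extension.ext ?_ ?_
  · simp [Extension.lift, (hy _).1, shift_zero_apply]
  · simp [Extension.lift, add_comm]

/-! ### The algebraic area -/

/-- The algebraic area as a homomorphism. -/
noncomputable def areaHom : H1 →ₗ[ℤ] ℤ :=
  Finsupp.linearCombination ℤ (fun _ : Z2 => (1 : ℤ)) ∘ₗ plaquetteEquiv.symm.toLinearMap

lemma areaHom_apply (γ : H1) : areaHom γ = area γ := by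
  simp [areaHom, area, Finsupp.linearCombination_apply]

lemma plaquetteEquiv_single (v : Z2) : plaquetteEquiv (Finsupp.single v 1) = plaquette v := by
  change plaquetteSum _ = _
  simp [plaquetteSum]

lemma area_plaquette (v : Z2) : area (plaquette v) = 1 := by
  rw [area, ← plaquetteEquiv_single, LinearEquiv.symm_apply_apply]
  simp

lemma shift_plaquette (v w : Z2) : shift v (plaquette w) = plaquette (v + w) :=
  Subtype.ext <| by simp [plaquette, plaquetteChain, add_assoc]

lemma h1_hom_ext {M : Type*} [AddCommGroup M] {f g : H1 →ₗ[ℤ] M}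
    (h : ∀ v, f (plaquette v) = g (plaquette v)) : f = g := by
  have : f ∘ₗ plaquetteEquiv.toLinearMap = g ∘ₗ plaquetteEquiv.toLinearMap := by
    refine Finsupp.lhom_ext' fun v => LinearMap.ext_ring ?_
    simpa [plaquetteEquiv_single] using h v
  refine LinearMap.ext fun γ => ?_
  simpa using LinearMap.congr_fun this (plaquetteEquiv.symm γ)

lemma areaHom_shift (v : Z2) (γ : H1) : areaHom (shift v γ) = areaHom γ := by
  have : areaHom ∘ₗ shift v = areaHom := h1_hom_ext fun w => by
    simp [areaHom_apply, shift_plaquette, area_plaquette]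
  exact LinearMap.congr_fun this γ

/-- The submodule `(e₁ - 1) H₁ + (e₂ - 1) H₁`, which is the product of `H₁(E²)` with the
augmentation ideal of the group ring. -/
noncomputable def augmentation : Submodule ℤ H1 :=
  LinearMap.range (shift (e 0) - LinearMap.id) ⊔ LinearMap.range (shift (e 1) - LinearMap.id)

lemma shift_sub_mem_augmentation (i : Fin 2) (γ : H1) : shift (e i) γ - γ ∈ augmentation := by
  fin_cases i
  · exact Submodule.mem_sup_left ⟨γ, rfl⟩
  · exact Submodule.mem_sup_right ⟨γ, rfl⟩

lemma mkQ_plaquette (v : Z2) :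
    augmentation.mkQ (plaquette v) = augmentation.mkQ (plaquette 0) := by
  have step : ∀ i v, augmentation.mkQ (plaquette (e i + v)) = augmentation.mkQ (plaquette v) := by
    intro i v
    rw [← sub_eq_zero, ← map_sub, Submodule.mkQ_apply, Submodule.Quotient.mk_eq_zero,
      ← shift_plaquette]
    exact shift_sub_mem_augmentation i _
  obtain ⟨m, n⟩ := v
  have h₁ := eq_of_increments (f := fun n => augmentation.mkQ (plaquette (m, n)))
    (g := fun _ => augmentation.mkQ (plaquette (m, 0))) rfl
    (fun n => by
      have := step 1 (m, n)
      simp only [e, Matrix.cons_val_one, Matrix.cons_val_fin_one, Prod.mk_add_mk, zero_add,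
        add_comm 1 n] at this
      rw [this, sub_self, sub_self]) n
  have h₀ := eq_of_increments (f := fun m => augmentation.mkQ (plaquette (m, 0)))
    (g := fun _ => augmentation.mkQ (plaquette (0, 0))) rfl
    (fun m => by
      have := step 0 (m, 0)
      simp only [e, Matrix.cons_val_zero, Prod.mk_add_mk, zero_add, add_comm 1 m] at this
      rw [this, sub_self, sub_self]) m
  exact h₁.trans h₀

/-- All plaquettes agree modulo `augmentation`, so the class of a cycle modulo `augmentation` is
determined by its area. -/
lemma mem_augmentation_of_area {γ : H1} (h : areaHom γ = 0) : γ ∈ augmentation := by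
  have : augmentation.mkQ
      = LinearMap.toSpanSingleton ℤ _ (augmentation.mkQ (plaquette 0)) ∘ₗ areaHom :=
    h1_hom_ext fun v => by
      simp only [LinearMap.comp_apply, areaHom_apply, area_plaquette,
        LinearMap.toSpanSingleton_apply, one_smul]
      exact mkQ_plaquette v
  have := LinearMap.congr_fun this γ
  rw [LinearMap.comp_apply, h, map_zero] at this
  simpa using this

/-! ### The isomorphism of the second cohomology group with the integers -/

lemma area_asymmetry_eq_of_class_eq {y y' : Cocycle2}
    (h : cohomologyClass y = cohomologyClass y') :
    areaHom (asymmetry y) = areaHom (asymmetry y') := by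
  obtain ⟨x, hx⟩ := cohomologyClass_eq_iff.1 h
  simp only [asymmetry_apply, hx, map_sub, map_add, areaHom_shift, add_comm (e 1) (e 0)]
  abel

namespace Extension

variable {y : Cocycle2} {hy : IsNormalized y}

/-- The projection of the extension onto `ℤ²`. -/
def baseHom (hy : IsNormalized y) : Extension y hy →* Multiplicative Z2 where
  toFun a := Multiplicative.ofAdd a.base
  map_one' := rfl
  map_mul' _ _ := rfl

@[simp] lemma baseHom_apply (a : Extension y hy) :
    baseHom hy a = Multiplicative.ofAdd a.base := rfl

/-- If the generators of `ℤ²` have commuting lifts `a` and `b`, then `(m, n) ↦ aᵐ bⁿ` splits the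
extension, so that the cocycle is a coboundary. -/
lemma class_eq_zero_of_commute {a b : Extension y hy} (ha : a.base = e 0) (hb : b.base = e 1)
    (hab : Commute a b) : cohomologyClass y = 0 := by
  let s : Z2 → Extension y hy := fun g => a ^ g.1 * b ^ g.2
  have hs : ∀ g h, s (g + h) = s g * s h := fun g h => by
    simp only [s, Prod.fst_add, Prod.snd_add, zpow_add]
    have := (hab.zpow_zpow h.1 g.2).eq
    rw [mul_assoc, mul_assoc, ← mul_assoc (a ^ h.1), this]
    simp only [mul_assoc]
  have hbase : ∀ g, (s g).base = g := fun g => by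
    have : baseHom hy (s g) = Multiplicative.ofAdd g := by
      simp only [s, map_mul, map_zpow, baseHom_apply, ha, hb, ← ofAdd_zsmul, ← ofAdd_add]
      simp [e]
    exact this
  have h0 : cohomologyClass 0 = 0 := map_zero (groupCohomology.H2π homologyRep).hom
  rw [← h0, cohomologyClass_eq_iff]
  refine ⟨fun g => -(s g).cycle, fun g h => ?_⟩
  have := congrArg Extension.cycle (hs g h)
  rw [mul_cycle (s g) (s h), hbase, hbase] at this
  change _ = 0 + (shift g (-(s h).cycle) - -(s (g + h)).cycle + -(s g).cycle)
  rw [this, map_neg]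
  abel

end Extension

/-- If the commutator cycle has area zero, it lies in `augmentation`; correcting the lifts of the
generators accordingly makes them commute. -/
lemma class_eq_zero_of_area {y : Cocycle2} (h : areaHom (asymmetry y) = 0) :
    cohomologyClass y = 0 := by
  obtain ⟨z, hz, hzy⟩ := exists_isNormalized (cohomologyClass y)
  rw [← area_asymmetry_eq_of_class_eq hzy] at h
  rw [← hzy]
  obtain ⟨_, ⟨α, rfl⟩, _, ⟨β, rfl⟩, hαβ⟩ := Submodule.mem_sup.1 (mem_augmentation_of_area h)
  refine Extension.class_eq_zero_of_commute (hy := hz) (a := ⟨β, e 0⟩) (b := ⟨-α, e 1⟩) rfl rfl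
    (Extension.ext ?_ (add_comm _ _))
  rw [asymmetry_apply] at hαβ
  simp only [Extension.mul_cycle, map_neg]
  simp only [LinearMap.sub_apply, LinearMap.id_apply] at hαβ
  rw [← sub_eq_zero] at hαβ ⊢
  rw [← neg_eq_zero, ← hαβ]
  abel

/-! ### The class of the path cocycles -/

lemma PathSystem.coe_val_cocycle (ω : PathSystem) (g h : Z2) :
    ((ω.cocycle.val g h : H1) : Chain1) = ω.loopChain g h := rfl

/-- The paths of two systems to the same point differ by a cycle, and these cycles form a cochain
whose coboundary is the difference of the cocycles. -/
lemma PathSystem.class_cocycle (ω : PathSystem) :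
    cohomologyClass ω.cocycle = metabelianClass := by
  refine cohomologyClass_eq_iff.2
    ⟨fun g => ⟨pathChain (ω.word g) - pathChain (standardPaths.word g), ?_⟩, fun g h => ?_⟩
  · rw [LinearMap.mem_ker, map_sub, ω.boundary_path, standardPaths.boundary_path, sub_self]
  · refine Subtype.ext ?_
    simp only [Submodule.coe_add, Submodule.coe_sub, coe_shift, PathSystem.coe_val_cocycle,
      PathSystem.loopChain, map_sub]
    abel

lemma asymmetry_standardPaths : asymmetry standardPaths.cocycle = plaquette 0 := by
  have h₀ : pathChain (standardPaths.word (e 0)) = edge 0 0 := by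
    change letterChain 0 (0, true) + 0 = _
    simp [letterChain]
  have h₁ : pathChain (standardPaths.word (e 1)) = edge 0 1 := by
    change letterChain 0 (1, true) + 0 = _
    simp [letterChain]
  refine Subtype.ext ?_
  rw [asymmetry_apply]
  simp only [Submodule.coe_sub, PathSystem.coe_val_cocycle, PathSystem.loopChain, h₀, h₁,
    shiftChain_edge, plaquette, plaquetteChain, add_comm (e 1) (e 0), zero_add, add_zero]
  abel

/-- The area of the commutator cycle as an isomorphism `H²(ℤ², H₁(E²)) ≃ ℤ`. -/
lemma exists_area_equiv :
    ∃ β : Cohomology2 ≃+ ℤ, ∀ y : Cocycle2,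
      β (cohomologyClass y) = areaHom (asymmetry y) := by
  let π : Cocycle2 →ₗ[ℤ] Cohomology2 := (groupCohomology.H2π homologyRep).hom
  have hπ : Function.Surjective π := fun x => by
    obtain ⟨y, -, hy⟩ := exists_isNormalized x
    exact ⟨y, hy⟩
  let S : Cocycle2 →ₗ[ℤ] ℤ := areaHom ∘ₗ asymmetry
  have hS : Function.Surjective S := fun n => ⟨n • standardPaths.cocycle, by
    simp [S, asymmetry_standardPaths, areaHom_apply, area_plaquette]⟩
  have hker : LinearMap.ker π = LinearMap.ker S := by
    ext y
    refine ⟨fun h => ?_, class_eq_zero_of_area⟩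
    have h0 : cohomologyClass y = cohomologyClass 0 := h.trans (map_zero π).symm
    have := area_asymmetry_eq_of_class_eq h0
    rwa [map_zero, map_zero] at this
  let β := (π.quotKerEquivOfSurjective hπ).symm ≪≫ₗ Submodule.quotEquivOfEq _ _ hker ≪≫ₗ
    S.quotKerEquivOfSurjective hS
  refine ⟨β.toAddEquiv, fun y => ?_⟩
  have : (π.quotKerEquivOfSurjective hπ).symm (π y) = Submodule.Quotient.mk y := by
    rw [LinearEquiv.symm_apply_eq]; rfl
  change S.quotKerEquivOfSurjective hS (Submodule.quotEquivOfEq _ _ hker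
    ((π.quotKerEquivOfSurjective hπ).symm (π y))) = _
  rw [this]
  rfl

lemma area_shiftedCommutatorCycle (y : Cocycle2) :
    area (shiftedCommutatorCycle y) = area (commutatorCycle y) := by
  simp only [← areaHom_apply, shiftedCommutatorCycle, commutatorCycle, map_add, map_sub,
    areaHom_shift]

/-! ### Words and homomorphisms from the free group -/

lemma shiftChain_letterChain (v w : Z2) (a : Fin 2 × Bool) :
    shiftChain v (letterChain w a) = letterChain (v + w) a := by
  rcases a with ⟨i, _ | _⟩ <;> simp [letterChain, add_sub_assoc]

lemma shiftChain_pathChainFrom (v w : Z2) (l : Word) :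
    shiftChain v (pathChainFrom w l) = pathChainFrom (v + w) l := by
  induction l generalizing w with
  | nil => simp [pathChainFrom]
  | cons a l ih => simp [pathChainFrom, ih, shiftChain_letterChain, add_assoc]

lemma pathChain_cons (a : Fin 2 × Bool) (l : Word) :
    pathChain (a :: l) = letterChain 0 a + shiftChain (letterStep a) (pathChain l) := by
  simp [pathChain, pathChainFrom, shiftChain_pathChainFrom]

lemma endpoint_cons (a : Fin 2 × Bool) (l : Word) :
    endpoint (a :: l) = letterStep a + endpoint l := by
  simp [endpoint]

lemma mk_cons (a : Fin 2 × Bool) (l : Word) :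
    FreeGroup.mk (a :: l)
      = (if a.2 then FreeGroup.of a.1 else (FreeGroup.of a.1)⁻¹) * FreeGroup.mk l := by
  rcases a with ⟨i, _ | _⟩ <;> simp [FreeGroup.of, FreeGroup.invRev, FreeGroup.mul_mk]

/-- If the images of the two generators commute, then the image of a word depends only on its end
point. -/
lemma map_mk_of_commute {C : Type*} [Group C] (f : FreeGroup (Fin 2) →* C)
    (h : Commute (f (FreeGroup.of 0)) (f (FreeGroup.of 1))) (w : Word) :
    f (FreeGroup.mk w)
      = f (FreeGroup.of 0) ^ (endpoint w).1 * f (FreeGroup.of 1) ^ (endpoint w).2 := by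
  induction w with
  | nil => simp [endpoint, ← FreeGroup.one_eq_mk]
  | cons a w ih =>
    rw [mk_cons, map_mul, ih, endpoint_cons]
    have h₁ := (h.zpow_left (endpoint w).1).eq
    have h₂ := (h.zpow_left (endpoint w).1).inv_right.eq
    rcases a with ⟨i, _ | _⟩ <;> fin_cases i
    · simp [letterStep, e, zpow_add, mul_assoc]
    · simp only [letterStep, e, zpow_add, map_inv, Bool.false_eq_true, if_false, ← mul_assoc,
        Fin.mk_one, Matrix.cons_val_one, Matrix.cons_val_fin_one, Prod.neg_mk, Prod.fst_add,
        Prod.snd_add, neg_zero, zpow_zero, zpow_neg_one, one_mul, h₂]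
    · simp [letterStep, e, zpow_add, mul_assoc]
    · simp only [letterStep, e, zpow_add, if_true, ← mul_assoc,
        Fin.mk_one, Matrix.cons_val_one, Matrix.cons_val_fin_one, Prod.fst_add,
        Prod.snd_add, zpow_zero, zpow_one, one_mul, h₁]

lemma exists_hom_of_commute {ι M : Type*} [Group M] (p : ι → M)
    (h : ∀ i j, Commute (p i) (p j)) :
    ∃ σ : Multiplicative (ι →₀ ℤ) →* M,
      ∀ i, σ (Multiplicative.ofAdd (Finsupp.single i 1)) = p i := by
  have hcomm : IsMulCommutative (Subgroup.closure (Set.range p)) :=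
    Subgroup.isMulCommutative_closure (by rintro _ ⟨i, rfl⟩ _ ⟨j, rfl⟩; exact h i j)
  let _ : CommGroup (Subgroup.closure (Set.range p)) := { mul_comm := hcomm.is_comm.comm }
  let τ : (ι →₀ ℤ) →+ Additive (Subgroup.closure (Set.range p)) :=
    Finsupp.liftAddHom fun i => zmultiplesHom _
      (Additive.ofMul ⟨p i, Subgroup.subset_closure ⟨i, rfl⟩⟩)
  refine ⟨(Subgroup.closure (Set.range p)).subtype.comp (AddMonoidHom.toMultiplicativeLeft τ),
    fun i => ?_⟩
  simp [τ]

/-! ### The Magnus embedding of the extension -/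

/-- A trivialization of a cocycle in the chains: a function `u` from `ℤ²` to the 1-chains such
that `u g` is bounded by `g` and the origin and `y` is the coboundary of `u`. It embeds
the extension of `ℤ²` by `y` into the semidirect product of the 1-chains with `ℤ²`. -/
structure Trivialization (y : Cocycle2) where
  /-- The chain assigned to a vertex. -/
  toFun : Z2 → Chain1
  /-- The chain of `g` leads from the origin to `g`. -/
  boundary_toFun : ∀ g, boundary (toFun g) = Finsupp.single g (1 : ℤ) - Finsupp.single 0 1
  /-- The coboundary of the chains is the cocycle. -/
  coe_val : ∀ g h, ((y.val g h : H1) : Chain1) = toFun g + shiftChain g (toFun h) - toFun (g + h)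

lemma exists_trivialization {y : Cocycle2} (h : cohomologyClass y = metabelianClass) :
    Nonempty (Trivialization y) := by
  obtain ⟨x, hx⟩ := cohomologyClass_eq_iff.1 h
  refine ⟨⟨fun g => pathChain (standardPaths.word g) + x g, fun g => ?_, fun g h => ?_⟩⟩
  · have : boundary (x g : Chain1) = 0 := (x g).2
    rw [map_add, this, add_zero, standardPaths.boundary_path]
  · rw [hx]
    simp only [Submodule.coe_add, Submodule.coe_sub, coe_shift, PathSystem.coe_val_cocycle,
      PathSystem.loopChain, map_add]
    abel

namespace Trivialization

variable {y : Cocycle2} (u : Trivialization y) {hy : IsNormalized y}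

lemma toFun_zero (hy : IsNormalized y) : u.toFun 0 = 0 := by
  have h := u.coe_val 0 0
  rw [(hy 0).1, shiftChain_zero, add_zero] at h
  simpa using h.symm

/-- The chain component of the embedding of the extension into the semidirect product. -/
noncomputable def chain (z : Extension y hy) : Chain1 := z.cycle + u.toFun z.base

lemma chain_mul (z z' : Extension y hy) :
    u.chain (z * z') = u.chain z + shiftChain z.base (u.chain z') := by
  simp only [chain, Extension.mul_cycle, Extension.mul_base, Submodule.coe_add, u.coe_val,
    coe_shift, map_add]
  abel

lemma chain_one : u.chain (1 : Extension y hy) = 0 := by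
  simp [chain, u.toFun_zero hy]

lemma chain_inv (z : Extension y hy) : u.chain z⁻¹ = -shiftChain (-z.base) (u.chain z) := by
  have := u.chain_mul z⁻¹ z
  rw [inv_mul_cancel, chain_one] at this
  exact eq_neg_of_add_eq_zero_left this.symm

lemma chain_of_base_eq_zero {z : Extension y hy} (hz : z.base = 0) : u.chain z = z.cycle := by
  rw [chain, hz, u.toFun_zero hy, add_zero]

variable (hy) in
/-- The lift of a generator of `ℤ²` whose chain is the edge leaving the origin. -/
noncomputable def gen (i : Fin 2) : Extension y hy where
  cycle := ⟨edge 0 i - u.toFun (e i), by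
    rw [LinearMap.mem_ker, map_sub, boundary_edge, u.boundary_toFun, zero_add, sub_self]⟩
  base := e i

lemma chain_gen (i : Fin 2) : u.chain (u.gen hy i) = edge 0 i := by
  simp [chain, gen]

variable (hy) in
/-- The homomorphism from the free group to the extension that sends `Xᵢ` to `gen i`; in the
semidirect product of the 1-chains with `ℤ²` it sends a word to the chain and the end point of its
path. -/
noncomputable def ofFree : FreeGroup (Fin 2) →* Extension y hy := FreeGroup.lift (u.gen hy)

lemma base_ofFree (w : Word) : (u.ofFree hy (FreeGroup.mk w)).base = endpoint w := by
  induction w with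
  | nil => rfl
  | cons a w ih =>
    rw [mk_cons, map_mul, Extension.mul_base, ih, endpoint_cons]
    rcases a with ⟨i, _ | _⟩ <;> simp [ofFree, letterStep, gen]

lemma chain_ofFree (w : Word) : u.chain (u.ofFree hy (FreeGroup.mk w)) = pathChain w := by
  induction w with
  | nil => exact u.chain_one
  | cons a w ih =>
    rw [mk_cons, map_mul, chain_mul, ih, pathChain_cons]
    rcases a with ⟨i, _ | _⟩
    · simp [ofFree, letterStep, letterChain, chain_inv, chain_gen]
      simp [gen]
    · simp [ofFree, letterStep, letterChain, chain_gen]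
      simp [gen]

end Trivialization

namespace Extension

variable {y : Cocycle2} (hy : IsNormalized y)

/-- The inclusion of the kernel `H₁(E²)` into the extension. -/
def incl : Multiplicative H1 →* Extension y hy where
  toFun γ := ⟨γ.toAdd, 0⟩
  map_one' := rfl
  map_mul' γ γ' := by
    refine Extension.ext ?_ (add_zero 0).symm
    simp [shift_zero_apply, (hy 0).1]

variable {hy}

lemma eq_incl_of_base_eq_zero {z : Extension y hy} (hz : z.base = 0) :
    z = incl hy (Multiplicative.ofAdd z.cycle) :=
  Extension.ext rfl hz

lemma conj_incl (z : Extension y hy) (γ : H1) :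
    z * incl hy (Multiplicative.ofAdd γ) * z⁻¹
      = incl hy (Multiplicative.ofAdd (shift z.base γ)) := by
  rw [mul_inv_eq_iff_eq_mul]
  refine Extension.ext ?_ ?_
  · simp [incl, (hy _).1, (hy _).2, shift_zero_apply, add_comm]
  · simp [incl]

lemma derivedSeries_two : derivedSeries (Extension y hy) 2 = ⊥ := by
  have h1 : derivedSeries (Extension y hy) 1 ≤ (baseHom hy).ker := by
    rw [derivedSeries_one]
    exact Abelianization.commutator_subset_ker _
  rw [derivedSeries_succ, eq_bot_iff, Subgroup.commutator_le]
  intro a ha b hb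
  rw [eq_incl_of_base_eq_zero (h1 ha), eq_incl_of_base_eq_zero (h1 hb), ← map_commutatorElement,
    commutatorElement_eq_one_iff_mul_comm.2 (mul_comm _ _), map_one]
  exact one_mem _

end Extension

/-! ### Metabelian groups with two generators -/

section Metabelian

variable {M : Type*} [Group M] (q : FreeGroup (Fin 2) →* M)

/-- The commutator of the images of the two generators. -/
def genCommutator : M := ⁅q (FreeGroup.of 0), q (FreeGroup.of 1)⁆

/-- The commutator of the generators, conjugated by the standard word of `v`. -/
noncomputable def conjCommutator (v : Z2) : M :=
  q (FreeGroup.mk (standardPaths.word v)) * genCommutator q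
    * (q (FreeGroup.mk (standardPaths.word v)))⁻¹

lemma genCommutator_mem : genCommutator q ∈ commutator M :=
  Subgroup.commutator_mem_commutator (Subgroup.mem_top _) (Subgroup.mem_top _)

lemma conjCommutator_mem (v : Z2) : conjCommutator q v ∈ commutator M :=
  (inferInstance : (commutator M).Normal).conj_mem _ (genCommutator_mem q) _

variable {q}

lemma commute_of_mem_commutator (hM : derivedSeries M 2 = ⊥) {a b : M}
    (ha : a ∈ commutator M) (hb : b ∈ commutator M) : Commute a b := by
  rw [derivedSeries_succ, derivedSeries_one] at hM
  have := Subgroup.commutator_mem_commutator ha hb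
  rw [hM, Subgroup.mem_bot] at this
  exact commutatorElement_eq_one_iff_mul_comm.1 this

/-- In a metabelian group a conjugate of the commutator of the generators depends only on the
end point of the conjugating word. -/
lemma conj_genCommutator (hM : derivedSeries M 2 = ⊥) (w : Word) :
    q (FreeGroup.mk w) * genCommutator q * (q (FreeGroup.mk w))⁻¹
      = conjCommutator q (endpoint w) := by
  have hend := standardPaths.endpoint_word (endpoint w)
  unfold conjCommutator
  set v := standardPaths.word (endpoint w)
  have hmem : (q (FreeGroup.mk v))⁻¹ * q (FreeGroup.mk w) ∈ commutator M := by
    rw [← Abelianization.ker_of, ← MonoidHom.eq_iff]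
    have key := map_mk_of_commute (Abelianization.of.comp q) (mul_comm _ _)
    have hw := key w
    rw [← hend, ← key v] at hw
    exact hw
  have := (commute_of_mem_commutator hM hmem (genCommutator_mem q)).eq
  rw [mul_inv_eq_iff_eq_mul]
  calc q (FreeGroup.mk w) * genCommutator q
      = q (FreeGroup.mk v) * ((q (FreeGroup.mk v))⁻¹ * q (FreeGroup.mk w) * genCommutator q) := by
        group
    _ = _ := by
        rw [this]
        group

/-- The elements whose word ends at the origin are products of conjugates of the commutator of
the generators. -/
lemma mem_normalClosure_of_endpoint {w : Word} (hw : endpoint w = 0) :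
    q (FreeGroup.mk w) ∈ Subgroup.normalClosure {genCommutator q} := by
  set N := Subgroup.normalClosure {genCommutator q}
  have hc : Commute ((QuotientGroup.mk' N).comp q (FreeGroup.of 0))
      ((QuotientGroup.mk' N).comp q (FreeGroup.of 1)) := by
    refine commutatorElement_eq_one_iff_mul_comm.1 ?_
    rw [← map_commutatorElement, MonoidHom.comp_apply, map_commutatorElement,
      QuotientGroup.mk'_apply, QuotientGroup.eq_one_iff]
    exact Subgroup.subset_normalClosure rfl
  have := map_mk_of_commute _ hc w
  rw [hw] at this
  simpa using this

end Metabelian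

/-- The Magnus embedding theorem for two generators. The conjugates of the commutator of the
generators generate the elements over the origin, commute, and are sent to the plaquettes;
as the plaquettes are free generators of `H₁(E²)`, nothing is killed. -/
theorem Trivialization.bijective {y : Cocycle2} {hy : IsNormalized y} (u : Trivialization y)
    {M : Type*} [Group M] {q : FreeGroup (Fin 2) →* M} (hq : Function.Surjective q)
    (hM : derivedSeries M 2 = ⊥) {φ : M →* Extension y hy}
    (hφ : ∀ w, φ (q w) = u.ofFree hy w) : Function.Bijective φ := by
  obtain ⟨σ, hσ⟩ := exists_hom_of_commute (conjCommutator q) fun v w =>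
    commute_of_mem_commutator hM (conjCommutator_mem q v) (conjCommutator_mem q w)
  have hgen : φ (genCommutator q) = Extension.incl hy (Multiplicative.ofAdd (plaquette 0)) := by
    let w : Word := [(0, true), (1, true), (0, false), (1, false)]
    have hw : φ (genCommutator q) = u.ofFree hy (FreeGroup.mk w) := by
      rw [← hφ, genCommutator, ← map_commutatorElement]
      rfl
    have hb : (u.ofFree hy (FreeGroup.mk w)).base = 0 := by
      rw [u.base_ofFree]
      simp [w, endpoint, letterStep]
    rw [hw, Extension.eq_incl_of_base_eq_zero hb]
    congr 2
    refine Subtype.ext ?_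
    rw [← u.chain_of_base_eq_zero hb, u.chain_ofFree]
    simp [w, pathChain, pathChainFrom, letterStep, letterChain, plaquette, plaquetteChain]
    abel
  have hconj : ∀ v, φ (conjCommutator q v)
      = Extension.incl hy (Multiplicative.ofAdd (plaquette v)) := fun v => by
    rw [conjCommutator, map_mul, map_mul, map_inv, hgen, Extension.conj_incl, hφ, u.base_ofFree,
      standardPaths.endpoint_word, shift_plaquette, add_zero]
  have hcomp : φ.comp σ
      = (Extension.incl hy).comp (AddMonoidHom.toMultiplicative plaquetteEquiv.toAddMonoidHom) := by
    refine Finsupp.mulHom_ext fun v n => ?_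
    have : Finsupp.single v n = n • Finsupp.single v (1 : ℤ) := by simp
    rw [this, ofAdd_zsmul, map_zpow, map_zpow]
    congr 1
    rw [MonoidHom.comp_apply, hσ, hconj, ← plaquetteEquiv_single]
    rfl
  have hincl : ∀ γ, Extension.incl hy (Multiplicative.ofAdd γ)
      = φ (σ (Multiplicative.ofAdd (plaquetteEquiv.symm γ))) := fun γ => by
    have := DFunLike.congr_fun hcomp (Multiplicative.ofAdd (plaquetteEquiv.symm γ))
    rw [MonoidHom.comp_apply] at this
    rw [this]
    exact congrArg (fun δ => Extension.incl hy (Multiplicative.ofAdd δ))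
      (plaquetteEquiv.apply_symm_apply γ).symm
  have hN : Subgroup.normalClosure {genCommutator q} ≤ σ.range := by
    refine (Subgroup.closure_le _).2 fun x hx => ?_
    obtain ⟨a, rfl, hax⟩ := Group.mem_conjugatesOfSet_iff.1 hx
    obtain ⟨g, rfl⟩ := isConj_iff.1 hax
    obtain ⟨⟨w⟩, rfl⟩ := hq g
    exact ⟨_, (hσ (endpoint w)).trans (conj_genCommutator hM w).symm⟩
  refine ⟨(injective_iff_map_eq_one φ).2 fun g hg => ?_, fun z => ?_⟩
  · obtain ⟨⟨w⟩, rfl⟩ := hq g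
    change φ (q (FreeGroup.mk w)) = 1 at hg
    have hw : endpoint w = 0 := by
      rw [← u.base_ofFree (hy := hy), ← hφ, hg]
      rfl
    obtain ⟨f, hf⟩ := hN (mem_normalClosure_of_endpoint (q := q) hw)
    change q (FreeGroup.mk w) = 1
    rw [← hf] at hg ⊢
    have h := congrArg Extension.cycle ((DFunLike.congr_fun hcomp f).symm.trans hg)
    have hf0 : f.toAdd = 0 := plaquetteEquiv.map_eq_zero_iff.1 h
    have : f = 1 := hf0
    rw [this, map_one]
  · let t := q (FreeGroup.mk (standardPaths.word z.base))
    have ht : (φ t).base = z.base := by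
      rw [hφ, u.base_ofFree, standardPaths.endpoint_word]
    have hb : (z * (φ t)⁻¹).base = 0 := by
      rw [Extension.mul_base, Extension.inv_base, ht, add_neg_cancel]
    have hz := (Extension.eq_incl_of_base_eq_zero hb).trans (hincl _)
    exact ⟨_ * t, by rw [map_mul, ← hz, inv_mul_cancel_right]⟩

lemma exists_met2_equiv {y : Cocycle2} (hy : IsNormalized y)
    (h : cohomologyClass y = metabelianClass) :
    ∃ Φ : Met2 ≃* Extension y hy, ∀ w : Word,
      (Φ (Met2.ofWord w)).base = endpoint w ∧
      (endpoint w = 0 → ((Φ (Met2.ofWord w)).cycle : Chain1) = pathChain w) := by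
  obtain ⟨u⟩ := exists_trivialization h
  have hker : derivedSeries (FreeGroup (Fin 2)) 2 ≤ (u.ofFree hy).ker := by
    rw [← MonoidHom.comap_bot, ← Extension.derivedSeries_two, ← Subgroup.map_le_iff_le_comap]
    exact map_derivedSeries_le_derivedSeries _ 2
  have hM : derivedSeries Met2 2 = ⊥ := by
    rw [← map_derivedSeries_eq (QuotientGroup.mk'_surjective _),
      QuotientGroup.map_mk'_self]
  let φ : Met2 →* Extension y hy := QuotientGroup.lift _ (u.ofFree hy) hker
  have hφ : Function.Bijective φ :=
    u.bijective (QuotientGroup.mk'_surjective _) hM fun _ => rfl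
  refine ⟨MulEquiv.ofBijective φ hφ, fun w => ⟨u.base_ofFree w, fun hw => ?_⟩⟩
  have hb : (u.ofFree hy (FreeGroup.mk w)).base = 0 := (u.base_ofFree w).trans hw
  exact (u.chain_of_base_eq_zero hb).symm.trans (u.chain_ofFree w)

end SquareLattice

theorem theorem7 :
    -- every class contains a normalized cocycle
    (∀ x : Cohomology2, ∃ y : Cocycle2, IsNormalized y ∧ cohomologyClass y = x) ∧
    -- the commutator of the lifts of the two generators is the cycle below
    (∀ (y : Cocycle2) (hy : IsNormalized y),
      Extension.lift hy (e 0) * Extension.lift hy (e 1)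
          * (Extension.lift hy (e 0))⁻¹ * (Extension.lift hy (e 1))⁻¹
        = (⟨commutatorCycle y, 0⟩ : Extension y hy)) ∧
    -- its area depends only on the class
    (∀ y y' : Cocycle2, IsNormalized y → IsNormalized y' →
      cohomologyClass y = cohomologyClass y' →
        area (commutatorCycle y) = area (commutatorCycle y')) ∧
    -- and gives an isomorphism, which sends the class of the free metabelian group to 1
    (∃ β : Cohomology2 ≃+ ℤ,
      (∀ y : Cocycle2, IsNormalized y →
        β (cohomologyClass y) = area (commutatorCycle y) ∧
        β (cohomologyClass y) = area (shiftedCommutatorCycle y)) ∧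
      β metabelianClass = 1) ∧
    -- this class is the class of all cocycles that come from systems of paths
    (∀ ω : PathSystem, cohomologyClass ω.cocycle = metabelianClass) ∧
    -- and it determines the extension isomorphic to the free metabelian group
    (∀ (y : Cocycle2) (hy : IsNormalized y), cohomologyClass y = metabelianClass →
      ∃ Φ : Met2 ≃* Extension y hy, ∀ w : Word,
        (Φ (Met2.ofWord w)).base = endpoint w ∧
        (endpoint w = 0 → ((Φ (Met2.ofWord w)).cycle : Chain1) = pathChain w)) := by
  refine ⟨exists_isNormalized, fun y hy => lift_commutator hy, fun y y' hy hy' h => ?_, ?_,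
    PathSystem.class_cocycle, fun y hy h => exists_met2_equiv hy h⟩
  · rw [commutatorCycle_eq hy, commutatorCycle_eq hy', ← areaHom_apply, ← areaHom_apply]
    exact area_asymmetry_eq_of_class_eq h
  · obtain ⟨β, hβ⟩ := exists_area_equiv
    refine ⟨β, fun y hy => ?_, ?_⟩
    · rw [area_shiftedCommutatorCycle, commutatorCycle_eq hy, ← areaHom_apply]
      exact ⟨hβ y, hβ y⟩
    · rw [metabelianClass, hβ, asymmetry_standardPaths, areaHom_apply, area_plaquette]
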